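/- Let $H$ be three-dimensional hyperbolic space, realised as the upper sheet of the unit hyperboloid in Minkowski space $\mathbb{R}^{3,1}$, with hyperbolic distance $d$ and Riemannian volume measure $dx$. For $p, r \ge 0$ let $$K_p(r) = \frac{\sin pr}{p \sinh r} \qquad (p, r > 0),$$ extended continuously by $K_p(0) = 1$ and $K_0(r) = r/\sinh r$, and write $K_p(x,y) = K_p(d(x,y))$ for $x, y \in H$. A finite graph with vertex set $V$ and edge set $E$ (loops and multiple edges allowed) is called integrable if for all edge labels $p : E \to [0,\infty)$, every vertex $w \in V$ and every point $x_w \in H$, the function $$(x_v)_{v \in V \setminus \{w\}} \longmapsto \prod_{e \in E} K_{p(e)}(x_{s(e)}, x_{t(e)})$$ is Lebesgue integrable on $H^{V \setminus \{w\}}$ with respect to the product measure $\prod_{v \ne w} dx_v$, where $s(e), t(e)$ are the endpoints of the edge $e$. **Theorem.** The tetrahedron, i.e. the complete graph on 4 vertices, is an integrable graph. That is, for all $p_{ij} \ge 0$ ($1 \le i < j \le 4$), every $w \in \{1,2,3,4\}$ and every $x_w \in H$, $$\int_{H^3} \Bigl|\prod_{1 \le i < j \le 4} K_{p_{ij}}(x_i,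 x_j)\Bigr| \prod_{v \ne w} dx_v < \infty .$$ -/

import Mathlib

open MeasureTheory
open scoped NNReal

/-- Euclidean three-space, the space part of four-dimensional Minkowski space. -/
abbrev E3 : Type := EuclideanSpace ℝ (Fin 3)

/-- The Minkowski bilinear form of signature `(-,+,+,+)` on `ℝ × ℝ³`
(time coordinate first). -/
noncomputable def minkowski (x y : ℝ × E3) : ℝ :=
  -(x.1 * y.1) + inner ℝ x.2 y.2

/-- Three-dimensional hyperbolic space: the upper sheet of the unit hyperboloid in Minkowski
space. As a subtype it carries the subspace topology and the corresponding Borel sets; the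
hyperbolic distance is `HypSpace.hdist` below, not the distance inherited from `ℝ × ℝ³`. -/
def HypSpace : Type := {x : ℝ × E3 // minkowski x x = -1 ∧ 0 < x.1}

namespace HypSpace

instance : TopologicalSpace HypSpace :=
  inferInstanceAs (TopologicalSpace {x : ℝ × E3 // minkowski x x = -1 ∧ 0 < x.1})

instance : MeasurableSpace HypSpace :=
  inferInstanceAs (MeasurableSpace {x : ℝ × E3 // minkowski x x = -1 ∧ 0 < x.1})

/-- The hyperbolic (geodesic) distance on the unit hyperboloid: `cosh d(x,y) = -⟨x,y⟩`. -/
noncomputable def hdist (x y : HypSpace) : ℝ := Real.arcosh (-minkowski x.1 y.1)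

theorem hdist_comm (x y : HypSpace) : hdist x y = hdist y x := by
  unfold hdist minkowski
  rw [real_inner_comm, mul_comm]

/-- The global chart of the hyperboloid: the point lying over `v ∈ ℝ³`,
with time coordinate `√(1 + |v|²)`. -/
noncomputable def param (v : E3) : HypSpace :=
  ⟨(Real.sqrt (1 + ‖v‖ ^ 2), v), by
    have h : 0 < 1 + ‖v‖ ^ 2 := by positivity
    refine ⟨?_, Real.sqrt_pos.2 h⟩
    simp only [minkowski, Real.mul_self_sqrt h.le, real_inner_self_eq_norm_sq]
    ring⟩

/-- The `i`-th coordinate tangent vector of the chart `param` at `v`, that is, the partial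
derivative of `v ↦ (√(1 + |v|²), v)` in the direction of the `i`-th standard basis vector. -/
noncomputable def tangentVec (v : E3) (i : Fin 3) : ℝ × E3 :=
  (v i / Real.sqrt (1 + ‖v‖ ^ 2), EuclideanSpace.single i 1)

/-- The Riemannian metric of the hyperboloid (the restriction of the Minkowski form to tangent
vectors), as a Gram matrix in the chart `param`. -/
noncomputable def metricMatrix (v : E3) : Matrix (Fin 3) (Fin 3) ℝ :=
  Matrix.of fun i j => minkowski (tangentVec v i) (tangentVec v j)

/-- The Riemannian volume measure `√(det g) d³v` of the unit hyperboloid. -/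
noncomputable def vol : Measure HypSpace :=
  ((volume : Measure E3).withDensity
    fun v => ENNReal.ofReal (Real.sqrt (metricMatrix v).det)).map param

end HypSpace

/-- The kernel `K_p(r) = sin (p r) / (p sinh r)` for `p, r > 0`, extended continuously to
`p, r ≥ 0` by `K_p(0) = 1` and `K_0(r) = r / sinh r`. -/
noncomputable def kernelK (p r : ℝ) : ℝ :=
  if r = 0 then 1
  else if p = 0 then r / Real.sinh r
  else Real.sin (p * r) / (p * Real.sinh r)

/-- A graph with vertex set `V` and edge set `E`, loops and multiple edges allowed: every edge
has an unordered pair of (possibly equal) endpoints. -/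
structure NetworkGraph (V E : Type) where
  /-- The two endpoints of an edge. -/
  ends : E → Sym2 V

namespace NetworkGraph

variable {V E : Type}

/-- The factor `K_p(x_a, x_b)` of an edge with label `p` and endpoints `a`, `b`, when the
points of hyperbolic space assigned to the vertices are `x`. -/
noncomputable def edgeFactor (x : V → HypSpace) (p : ℝ≥0) (e : Sym2 V) : ℝ :=
  Sym2.lift ⟨fun a b => kernelK p (HypSpace.hdist (x a) (x b)),
    fun a b => by simp only [HypSpace.hdist_comm]⟩ e

/-- The product over all edges of the kernels, the edge `e` being labelled by `p e`. -/
noncomputable def integrand [Fintype E] (G : NetworkGraph V E) (p : E → ℝ≥0)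
    (x : V → HypSpace) : ℝ :=
  ∏ e, edgeFactor x (p e) (G.ends e)

/-- The assignment of points to all vertices that gives `xw` to the vertex `w` and `y` to the
others. -/
def extend [DecidableEq V] (w : V) (xw : HypSpace) (y : {v : V // v ≠ w} → HypSpace) :
    V → HypSpace :=
  fun v => if h : v = w then xw else y ⟨v, h⟩

/-- The relativistic spin network `(G, p)` is integrable: whichever vertex `w` is omitted from
the integration and wherever its point `xw` lies, the integrand is Lebesgue integrable over the
points of hyperbolic space assigned to the remaining vertices. -/
def NetworkIntegrable [Fintype V] [DecidableEq V] [Fintype E] (G : NetworkGraph V E)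
    (p : E → ℝ≥0) : Prop :=
  ∀ (w : V) (xw : HypSpace),
    Integrable (fun y : {v : V // v ≠ w} → HypSpace => G.integrand p (extend w xw y))
      (Measure.pi fun _ => HypSpace.vol)

/-- A graph is integrable if it gives an integrable relativistic spin network for all edge
labels `p ≥ 0`. -/
def IsIntegrable [Fintype V] [DecidableEq V] [Fintype E] (G : NetworkGraph V E) : Prop :=
  ∀ p : E → ℝ≥0, G.NetworkIntegrable p

/-- A simple graph, with its own edges. -/
def ofSimpleGraph (G : SimpleGraph V) : NetworkGraph V G.edgeSet where
  ends e := e.1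

end NetworkGraph

/-- The tetrahedron: the complete graph on four vertices. -/
def tetrahedron : NetworkGraph (Fin 4) (⊤ : SimpleGraph (Fin 4)).edgeSet :=
  NetworkGraph.ofSimpleGraph ⊤

/-!
# The tetrahedron is an integrable graph

Since `|sin (p r)| ≤ p r`, every kernel `K_p` is dominated by `K_0(r) = r / sinh r`, and hence by a
constant times `(cosh r) ^ (-9/10)` (`abs_kernelK_le`); giving up a tenth of the exponential rate
absorbs the factor `r`. In the chart over `v ∈ ℝ³`, with `t = √(1 + |v|²)`, the distance is given by
`cosh d = t t' - ⟨v, v'⟩` and the volume is `d³v / t`, so only powers of elementary expressions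
remain. The edges at the fixed vertex contribute, up to a constant depending on the fixed point,
the factors `t ^ (-9/10)`, wherever that point lies (`HypSpace.exists_decay_le_height_rpow`). No
isometry of hyperbolic space is needed to move it to the apex `o` of the hyperboloid.

Among the three free points let `x` be one farthest from `o`. The edge between the other two may
be dropped, its weight being at most `1`; these two points then decouple, and the integral over
both is `J(x)²`, where `J(x)` is the integral over the points `y` with `d(o, y) ≤ d(o, x)` of the
product of the weights of the edges from `y` to `o` and to `x` (`HypSpace.ofReal_prod_decay_le`,
`HypSpace.lintegral_outermost`). Without the restriction on `y` this integral diverges.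

To estimate `J(x)`, write `R = |v_x|` and take orthonormal coordinates `(a, b, c)` of `v` with the
first axis along `v_x`. Then `cosh d(x, y) ≥ R (|v| - a) ≥ R (b² + c²) / (2 |v|)`, and
`|v| ≥ |a|, |b|, |c|`, so that the integrand is at most a constant times
`R ^ (-9/10) |a| ^ (-9/10) |b| ^ (-19/20) |c| ^ (-19/20)` (`rpow_mul_rpow_le`). All exponents exceed
`-1`, and integration over the cube `[-R, R]³` gives `J(x) ≤ C R ^ (-7/10)`
(`exists_lintegral_decay_le`). What is left is `∫ t ^ (-19/10) R ^ (-7/5) d³v`, finite because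
`7/5 < 3 < 19/10 + 7/5` (`integrable_sqrt_rpow_mul_norm_rpow`).
-/

/-! ### Bounds for the kernels -/

theorem div_sinh_le_cosh_rpow {r : ℝ} (hr : 0 < r) :
    r / Real.sinh r ≤ 40 * Real.cosh r ^ (-(9 / 10) : ℝ) := by
  have hs : 0 < Real.sinh r := Real.sinh_pos_iff.2 hr
  have hc : 1 ≤ Real.cosh r := Real.one_le_cosh r
  have hc0 : 0 < Real.cosh r := by linarith
  rw [Real.rpow_neg hc0.le, ← div_eq_mul_inv, div_le_div_iff₀ hs (by positivity)]
  rcases le_total r 1 with h1 | h1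
  · have h2 : Real.cosh r ≤ 3 := by
      have h3 := Real.cosh_le_cosh.2 (show |r| ≤ |1| by rw [abs_of_pos hr]; simpa using h1)
      have h4 := Real.exp_one_lt_d9
      have h5 : Real.exp (-1) ≤ 1 := Real.exp_le_one_iff.2 (by norm_num)
      rw [Real.cosh_eq 1] at h3
      linarith
    have h3 : Real.cosh r ^ (9 / 10 : ℝ) ≤ Real.cosh r :=
      (Real.rpow_le_rpow_of_exponent_le hc (by norm_num)).trans (Real.rpow_one _).le
    have h4 : r ≤ Real.sinh r := Real.self_le_sinh_iff.2 hr.le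
    nlinarith
  · have h2 : Real.cosh r ≤ 2 * Real.sinh r := by
      have h5 : Real.exp (-r) ≤ 1 := Real.exp_le_one_iff.2 (by linarith)
      have h6 := Real.add_one_le_exp r
      have h7 : Real.exp r * Real.exp (-r) = 1 := by rw [← Real.exp_add]; simp
      have h8 := Real.exp_one_gt_d9
      have h9 : Real.exp 1 ≤ Real.exp r := Real.exp_le_exp.2 h1
      rw [Real.cosh_eq, Real.sinh_eq]
      nlinarith
    -- the polynomial factor `r` costs a tenth of the exponential rate
    have h3 : r ≤ 10 * Real.exp (r / 10) := by linarith [Real.add_one_le_exp (r / 10)]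
    have h4 : Real.exp (r / 10) ≤ 2 * Real.cosh r ^ (1 / 10 : ℝ) := by
      have : Real.exp (r / 10) = Real.exp r ^ (1 / 10 : ℝ) := by
        rw [← Real.exp_mul]; ring_nf
      rw [this]
      have h5 : Real.exp r ≤ 2 * Real.cosh r := by
        rw [Real.cosh_eq]; linarith [Real.exp_pos (-r)]
      calc _ ≤ (2 * Real.cosh r) ^ (1 / 10 : ℝ) :=
            Real.rpow_le_rpow (Real.exp_pos _).le h5 (by norm_num)
        _ = 2 ^ (1 / 10 : ℝ) * Real.cosh r ^ (1 / 10 : ℝ) :=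
            Real.mul_rpow (by norm_num) hc0.le
        _ ≤ _ := by
            gcongr
            calc (2 : ℝ) ^ (1 / 10 : ℝ) ≤ 2 ^ (1 : ℝ) :=
                  Real.rpow_le_rpow_of_exponent_le (by norm_num) (by norm_num)
              _ = 2 := Real.rpow_one _
    calc r * Real.cosh r ^ (9 / 10 : ℝ)
        ≤ (20 * Real.cosh r ^ (1 / 10 : ℝ)) * Real.cosh r ^ (9 / 10 : ℝ) := by
          gcongr; linarith
      _ = 20 * Real.cosh r := by
          rw [mul_assoc, ← Real.rpow_add hc0]; norm_num
      _ ≤ _ := by linarith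

theorem abs_kernelK_le {p r : ℝ} (hp : 0 ≤ p) (hr : 0 ≤ r) :
    |kernelK p r| ≤ 40 * Real.cosh r ^ (-(9 / 10) : ℝ) := by
  unfold kernelK
  split_ifs with h0 h1
  · subst h0; simp
  · have hr' : 0 < r := lt_of_le_of_ne hr (Ne.symm h0)
    rw [abs_of_nonneg (div_nonneg hr (Real.sinh_nonneg_iff.2 hr))]
    exact div_sinh_le_cosh_rpow hr'
  · have hr' : 0 < r := lt_of_le_of_ne hr (Ne.symm h0)
    have hp' : 0 < p := lt_of_le_of_ne hp (Ne.symm h1)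
    have hs : 0 < Real.sinh r := Real.sinh_pos_iff.2 hr'
    refine le_trans ?_ (div_sinh_le_cosh_rpow hr')
    rw [abs_div, abs_of_pos (mul_pos hp' hs), div_le_div_iff₀ (mul_pos hp' hs) hs]
    have h2 : |Real.sin (p * r)| ≤ p * r := by
      simpa [abs_of_pos hp', abs_of_pos hr'] using Real.abs_sin_le_abs (x := p * r)
    nlinarith

/-! ### Heights and distances on the hyperboloid -/

namespace HypSpace

/-- `cosh d(x, y)`, in the form of the Minkowski product that defines the distance. -/
noncomputable def coshDist (x y : HypSpace) : ℝ := -minkowski x.1 y.1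

/-- The time coordinate of a point of the hyperboloid, which is `cosh d(o, x)` for the apex `o`. -/
def height (x : HypSpace) : ℝ := x.1.1

theorem coshDist_comm (x y : HypSpace) : coshDist x y = coshDist y x := by
  unfold coshDist minkowski
  rw [real_inner_comm, mul_comm]

theorem height_sq (x : HypSpace) : height x ^ 2 = 1 + ‖x.1.2‖ ^ 2 := by
  have := x.2.1
  simp only [minkowski, real_inner_self_eq_norm_sq] at this
  unfold height
  linarith

theorem height_pos (x : HypSpace) : 0 < height x := x.2.2

theorem norm_lt_height (x : HypSpace) : ‖x.1.2‖ < height x := by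
  have := height_sq x
  have := height_pos x
  nlinarith [norm_nonneg x.1.2]

theorem height_mul_sub_le_coshDist (x y : HypSpace) :
    height x * height y - ‖x.1.2‖ * ‖y.1.2‖ ≤ coshDist x y := by
  have := real_inner_le_norm x.1.2 y.1.2
  unfold coshDist minkowski height
  linarith

theorem one_le_coshDist (x y : HypSpace) : 1 ≤ coshDist x y := by
  refine le_trans ?_ (height_mul_sub_le_coshDist x y)
  have hx := height_sq x
  have hy := height_sq y
  have h3 : ‖x.1.2‖ * ‖y.1.2‖ + 1 ≤ height x * height y := by
    refine abs_le_of_sq_le_sq' ?_ (mul_pos (height_pos x) (height_pos y)).le |>.2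
    rw [mul_pow, hx, hy]
    nlinarith [sq_nonneg (‖x.1.2‖ - ‖y.1.2‖)]
  linarith

theorem hdist_nonneg (x y : HypSpace) : 0 ≤ hdist x y := Real.arcosh_nonneg (one_le_coshDist x y)

theorem cosh_hdist (x y : HypSpace) : Real.cosh (hdist x y) = coshDist x y :=
  Real.cosh_arcosh (one_le_coshDist x y)

/-- The weight `(cosh d(x, y)) ^ (-9/10)`, which up to a constant dominates every kernel `K_p`. -/
noncomputable def decay (x y : HypSpace) : ℝ := coshDist x y ^ (-(9 / 10) : ℝ)

theorem decay_comm (x y : HypSpace) : decay x y = decay y x := by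
  unfold decay; rw [coshDist_comm]

theorem decay_nonneg (x y : HypSpace) : 0 ≤ decay x y :=
  Real.rpow_nonneg (zero_le_one.trans (one_le_coshDist x y)) _

theorem decay_le_one (x y : HypSpace) : decay x y ≤ 1 :=
  Real.rpow_le_one_of_one_le_of_nonpos (one_le_coshDist x y) (by norm_num)

theorem abs_kernelK_hdist_le (p : ℝ≥0) (x y : HypSpace) :
    |kernelK p (hdist x y)| ≤ 40 * decay x y := by
  have := abs_kernelK_le p.2 (hdist_nonneg x y)
  rwa [cosh_hdist] at this

/-- Seen from a fixed point `x`, the weight decays as it does seen from the apex. -/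
theorem exists_decay_le_height_rpow (x : HypSpace) :
    ∃ C : ℝ, 0 ≤ C ∧ ∀ y, decay x y ≤ C * height y ^ (-(9 / 10) : ℝ) := by
  have hx : 0 < height x - ‖x.1.2‖ := sub_pos.2 (norm_lt_height x)
  refine ⟨(height x - ‖x.1.2‖) ^ (-(9 / 10) : ℝ), by positivity, fun y => ?_⟩
  have hy := height_pos y
  rw [← Real.mul_rpow hx.le hy.le]
  refine Real.rpow_le_rpow_of_nonpos (mul_pos hx hy) ?_ (by norm_num)
  refine le_trans ?_ (height_mul_sub_le_coshDist x y)
  nlinarith [norm_nonneg x.1.2, norm_lt_height y]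

end HypSpace

/-! ### Power integrals in Euclidean space -/

/-- The power `|x| ^ (-β)` cut off outside the interval `[-R, R]`. At `x = 0` the value for `β ≠ 0`
is `0`, so upper bounds by it are available only for `x ≠ 0`. -/
noncomputable def truncPow (R β x : ℝ) : ℝ := if |x| ≤ R then |x| ^ (-β) else 0

theorem truncPow_nonneg (R β x : ℝ) : 0 ≤ truncPow R β x := by
  unfold truncPow
  split_ifs
  · positivity
  · rfl

theorem truncPow_eq_indicator (R β x : ℝ) :
    truncPow R β x = (Set.Iic R).indicator (fun y => y ^ (-β)) |x| := by
  simp [truncPow, Set.indicator_apply]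

theorem integrable_truncPow {R β : ℝ} (hR : 0 ≤ R) (hβ : β < 1) : Integrable (truncPow R β) := by
  have h : truncPow R β = fun x : ℝ => (Set.Iic R).indicator (fun y => y ^ (-β)) ‖x‖ :=
    funext fun x => truncPow_eq_indicator R β x
  rw [h, integrable_fun_norm_addHaar]
  simp only [Module.finrank_self, Nat.sub_self, pow_zero, one_smul]
  rw [integrableOn_indicator_iff measurableSet_Iic, Set.inter_comm, Set.Ioi_inter_Iic,
    ← intervalIntegrable_iff_integrableOn_Ioc_of_le hR]
  exact intervalIntegral.intervalIntegrable_rpow' (by linarith)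

theorem integral_truncPow {R β : ℝ} (hR : 0 ≤ R) (hβ : β < 1) :
    ∫ x, truncPow R β x = 2 / (1 - β) * R ^ (1 - β) := by
  simp_rw [truncPow_eq_indicator]
  rw [integral_comp_abs, setIntegral_indicator measurableSet_Iic, Set.Ioi_inter_Iic,
    ← intervalIntegral.integral_of_le hR, integral_rpow (Or.inl (by linarith)),
    Real.zero_rpow (by linarith), show -β + 1 = 1 - β by ring]
  ring

/-- Tonelli's theorem for a product of functions of the single Euclidean coordinates. -/
theorem lintegral_prod_ofReal {n : ℕ} {f : Fin n → ℝ → ℝ} (hf : ∀ i, Integrable (f i))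
    (h0 : ∀ i x, 0 ≤ f i x) :
    ∫⁻ v : EuclideanSpace ℝ (Fin n), ENNReal.ofReal (∏ i, f i (v i)) =
      ENNReal.ofReal (∏ i, ∫ x, f i x) := by
  have h := (EuclideanSpace.volume_preserving_symm_measurableEquiv_toLp (Fin n)).lintegral_comp_emb
    (MeasurableEquiv.measurableEmbedding _) (fun x => ENNReal.ofReal (∏ i, f i (x i)))
  refine h.trans ?_
  rw [volume_pi, ← ofReal_integral_eq_lintegral_ofReal (Integrable.fin_nat_prod hf)
    (Filter.Eventually.of_forall fun x => Finset.prod_nonneg fun i _ => h0 i _),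
    integral_fin_nat_prod_eq_prod]

/-- A nonzero vector points along the first axis of some orthonormal basis. -/
theorem exists_orthonormalBasis_smul_eq {u : E3} (hu : u ≠ 0) :
    ∃ b : OrthonormalBasis (Fin 3) ℝ E3, u = ‖u‖ • b 0 := by
  have hn : ‖u‖ ≠ 0 := norm_ne_zero_iff.2 hu
  obtain ⟨b, hb⟩ := Orthonormal.exists_orthonormalBasis_extension_of_card_eq (𝕜 := ℝ) (E := E3)
    (ι := Fin 3) (by simp) (v := fun _ => ‖u‖⁻¹ • u) (s := {0}) (by
      constructor
      · rintro ⟨i, hi⟩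
        simp [norm_smul, inv_mul_cancel₀ hn]
      · rintro ⟨i, hi⟩ ⟨j, hj⟩ hij
        exact absurd (Subtype.ext (hi.trans hj.symm)) hij)
  refine ⟨b, ?_⟩
  rw [hb 0 rfl, smul_smul, mul_inv_cancel₀ hn, one_smul]

theorem ae_coord_ne_zero {n : ℕ} :
    ∀ᵐ v : EuclideanSpace ℝ (Fin n), ∀ i, v i ≠ 0 := by
  have h := (EuclideanSpace.volume_preserving_symm_measurableEquiv_toLp (Fin n))
  have h2 : ∀ᵐ x : Fin n → ℝ, ∀ i, x i ≠ 0 := by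
    rw [ae_all_iff]
    intro i
    rw [ae_iff]
    simpa [volume_pi] using Measure.pi_hyperplane (fun _ : Fin n => (volume : Measure ℝ)) i 0
  exact h.quasiMeasurePreserving.ae h2

/-- In orthonormal coordinates `(a, b, c)` whose first axis points to a point at Euclidean distance
`R` in the chart, the integrand `t ^ (-19/10) q ^ (-9/10)` at Euclidean distance `n` is bounded by a
product of powers of the single coordinates. All these powers are locally integrable. -/
theorem rpow_mul_rpow_le {R n t q a b c : ℝ} (hR : 0 < R) (hn : n ^ 2 = a ^ 2 + b ^ 2 + c ^ 2)
    (hn0 : 0 ≤ n) (ha : a ≠ 0) (hb : b ≠ 0) (hc : c ≠ 0) (ht : n ≤ t) (hq : R * (n - a) ≤ q) :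
    t ^ (-(19 / 10) : ℝ) * q ^ (-(9 / 10) : ℝ) ≤
      2 * R ^ (-(9 / 10) : ℝ) *
        (|a| ^ (-(9 / 10) : ℝ) * |b| ^ (-(19 / 20) : ℝ) * |c| ^ (-(19 / 20) : ℝ)) := by
  have ha' : 0 < |a| := abs_pos.2 ha
  have hb' : 0 < |b| := abs_pos.2 hb
  have hc' : 0 < |c| := abs_pos.2 hc
  have han : |a| ≤ n := abs_le_of_sq_le_sq (by nlinarith [sq_nonneg b, sq_nonneg c]) hn0
  have hbn : |b| ≤ n := abs_le_of_sq_le_sq (by nlinarith [sq_nonneg a, sq_nonneg c]) hn0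
  have hcn : |c| ≤ n := abs_le_of_sq_le_sq (by nlinarith [sq_nonneg b, sq_nonneg a]) hn0
  have hn1 : 0 < n := ha'.trans_le han
  -- `n - a = (b² + c²) / (n + a)`, and `2 n` bounds the denominator
  have hq' : R * (|b| * |c|) / (2 * n) ≤ q := by
    refine le_trans ?_ hq
    rw [div_le_iff₀ (by positivity), mul_assoc]
    refine mul_le_mul_of_nonneg_left ?_ hR.le
    have h1 : 0 ≤ n - a := by linarith [le_abs_self a]
    have h2 : n + a ≤ 2 * n := by linarith [le_abs_self a]
    have h3 : |b| * |c| ≤ b ^ 2 + c ^ 2 := by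
      rw [← sq_abs b, ← sq_abs c]; nlinarith [sq_nonneg (|b| - |c|)]
    have h4 := mul_le_mul_of_nonneg_left h2 h1
    nlinarith
  have hq0 : 0 < R * (|b| * |c|) / (2 * n) := by positivity
  calc t ^ (-(19 / 10) : ℝ) * q ^ (-(9 / 10) : ℝ)
      ≤ n ^ (-(19 / 10) : ℝ) * (R * (|b| * |c|) / (2 * n)) ^ (-(9 / 10) : ℝ) :=
        mul_le_mul (Real.rpow_le_rpow_of_nonpos hn1 ht (by norm_num))
          (Real.rpow_le_rpow_of_nonpos hq0 hq' (by norm_num))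
          (Real.rpow_nonneg (hq0.le.trans hq') _) (by positivity)
    _ = 2 ^ (9 / 10 : ℝ) * R ^ (-(9 / 10) : ℝ) * (n ^ (-(9 / 10) : ℝ) *
        (|b| ^ (-(9 / 10) : ℝ) * n ^ (-(1 / 20) : ℝ)) *
          (|c| ^ (-(9 / 10) : ℝ) * n ^ (-(1 / 20) : ℝ))) := by
        rw [Real.div_rpow (by positivity) (by positivity), Real.mul_rpow hR.le (by positivity),
          Real.mul_rpow hb'.le hc'.le, Real.mul_rpow (by norm_num) hn1.le,
          Real.rpow_neg (by norm_num : (0 : ℝ) ≤ 2), div_eq_mul_inv (_ * _), mul_inv, inv_inv,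
          ← Real.rpow_neg hn1.le, neg_neg]
        have h1 : n ^ (-(19 / 10) : ℝ) * n ^ (9 / 10 : ℝ) =
            n ^ (-(9 / 10) : ℝ) * n ^ (-(1 / 20) : ℝ) * n ^ (-(1 / 20) : ℝ) := by
          rw [← Real.rpow_add hn1, ← Real.rpow_add hn1, ← Real.rpow_add hn1]; norm_num
        linear_combination (2 ^ (9 / 10 : ℝ) * R ^ (-(9 / 10) : ℝ) *
          |b| ^ (-(9 / 10) : ℝ) * |c| ^ (-(9 / 10) : ℝ)) * h1
    _ ≤ 2 * R ^ (-(9 / 10) : ℝ) * (|a| ^ (-(9 / 10) : ℝ) *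
        (|b| ^ (-(9 / 10) : ℝ) * |b| ^ (-(1 / 20) : ℝ)) *
          (|c| ^ (-(9 / 10) : ℝ) * |c| ^ (-(1 / 20) : ℝ))) := by
        have h2 : (2 : ℝ) ^ (9 / 10 : ℝ) ≤ 2 :=
          (Real.rpow_le_rpow_of_exponent_le (by norm_num) (by norm_num)).trans (Real.rpow_one _).le
        have h3 := Real.rpow_le_rpow_of_nonpos ha' han (by norm_num : (-(9 / 10) : ℝ) ≤ 0)
        have h4 := Real.rpow_le_rpow_of_nonpos hb' hbn (by norm_num : (-(1 / 20) : ℝ) ≤ 0)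
        have h5 := Real.rpow_le_rpow_of_nonpos hc' hcn (by norm_num : (-(1 / 20) : ℝ) ≤ 0)
        gcongr
    _ = _ := by
        rw [← Real.rpow_add hb', ← Real.rpow_add hc']; norm_num

/-- The integral of the weights of the edges from `v` to the apex and to `u`, over the points `v` no
farther from the apex than `u`, in the chart. The exponent `-19/10 = -9/10 - 1` includes the volume
density. -/
theorem exists_lintegral_decay_le :
    ∃ C : ℝ, 0 ≤ C ∧ ∀ u : E3, u ≠ 0 →
      ∫⁻ v : E3, (if ‖v‖ ≤ ‖u‖ then ENNReal.ofReal (Real.sqrt (1 + ‖v‖ ^ 2) ^ (-(19 / 10) : ℝ) *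
        (Real.sqrt (1 + ‖u‖ ^ 2) * Real.sqrt (1 + ‖v‖ ^ 2) - inner ℝ u v) ^ (-(9 / 10) : ℝ))
          else 0) ≤ ENNReal.ofReal (C * ‖u‖ ^ (-(7 / 10) : ℝ)) := by
  refine ⟨64000, by norm_num, fun u hu => ?_⟩
  set R := ‖u‖ with hRdef
  have hR : 0 < R := norm_pos_iff.2 hu
  obtain ⟨b, hb⟩ := exists_orthonormalBasis_smul_eq hu
  let β : Fin 3 → ℝ := ![9 / 10, 19 / 20, 19 / 20]
  have hβ : ∀ i, β i < 1 := by intro i; fin_cases i <;> simp [β] <;> norm_num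
  -- where a coordinate vanishes, `truncPow` takes the value `0` and is no upper bound
  have hae : ∀ᵐ v : E3, ∀ i, b.repr v i ≠ 0 :=
    b.measurePreserving_repr.quasiMeasurePreserving.ae ae_coord_ne_zero
  calc _ ≤ ∫⁻ v : E3, ENNReal.ofReal (2 * R ^ (-(9 / 10) : ℝ)) *
        ENNReal.ofReal (∏ i, truncPow R (β i) (b.repr v i)) := by
        refine lintegral_mono_ae ?_
        filter_upwards [hae] with v hv
        split_ifs with hvR
        swap
        · exact zero_le
        rw [← ENNReal.ofReal_mul (by positivity)]
        refine ENNReal.ofReal_le_ofReal ?_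
        have hnorm : ‖v‖ ^ 2 = b.repr v 0 ^ 2 + b.repr v 1 ^ 2 + b.repr v 2 ^ 2 := by
          rw [← b.repr.norm_map v, EuclideanSpace.norm_sq_eq, Fin.sum_univ_three]
          simp only [Real.norm_eq_abs, sq_abs]
        have hle : ∀ i, |b.repr v i| ≤ R := fun i => by
          have := PiLp.norm_apply_le (b.repr v) i
          rw [b.repr.norm_map] at this
          exact this.trans hvR
        have hin : inner ℝ u v = R * b.repr v 0 := by
          rw [hb, inner_smul_left, b.repr_apply_apply]; simp [hRdef]
        have ht : ‖v‖ ≤ Real.sqrt (1 + ‖v‖ ^ 2) := Real.le_sqrt_of_sq_le (by linarith)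
        have htR : R ≤ Real.sqrt (1 + R ^ 2) := Real.le_sqrt_of_sq_le (by linarith)
        have := rpow_mul_rpow_le
          (q := Real.sqrt (1 + R ^ 2) * Real.sqrt (1 + ‖v‖ ^ 2) - inner ℝ u v)
          hR hnorm (norm_nonneg v) (hv 0) (hv 1) (hv 2) ht (by
            rw [hin, mul_sub]
            gcongr)
        refine this.trans_eq ?_
        rw [Fin.prod_univ_three]
        simp only [truncPow, if_pos (hle _)]
        simp [β]
    _ = ENNReal.ofReal (2 * R ^ (-(9 / 10) : ℝ)) *
        ENNReal.ofReal (∏ i, ∫ x, truncPow R (β i) x) := by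
        rw [lintegral_const_mul' _ _ ENNReal.ofReal_ne_top, ← lintegral_prod_ofReal
          (fun i => integrable_truncPow hR.le (hβ i)) (fun i x => truncPow_nonneg _ _ _)]
        congr 1
        exact b.measurePreserving_repr.lintegral_comp_emb
          b.repr.toHomeomorph.measurableEmbedding
          (fun w : E3 => ENNReal.ofReal (∏ i, truncPow R (β i) (w i)))
    _ ≤ _ := by
        rw [← ENNReal.ofReal_mul (by positivity)]
        refine ENNReal.ofReal_le_ofReal (le_of_eq ?_)
        simp_rw [fun i => integral_truncPow hR.le (hβ i)]
        rw [Fin.prod_univ_three]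
        have h : R ^ (-(7 / 10) : ℝ) =
            R ^ (-(9 / 10) : ℝ) * R ^ (1 - 9 / 10 : ℝ) * R ^ (1 - 19 / 20 : ℝ)
              * R ^ (1 - 19 / 20 : ℝ) := by
          rw [← Real.rpow_add hR, ← Real.rpow_add hR, ← Real.rpow_add hR]; norm_num
        rw [h]
        simp only [β, Matrix.cons_val_zero, Matrix.cons_val_one, Matrix.cons_val]
        ring

/-- The remaining integral, over the point farthest from the apex. The exponents leave room both
at the apex, `-7/5 > -3`, and at infinity, `-19/10 - 7/5 < -3`. -/
theorem integrable_sqrt_rpow_mul_norm_rpow :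
    Integrable fun v : E3 =>
      Real.sqrt (1 + ‖v‖ ^ 2) ^ (-(19 / 10) : ℝ) * ‖v‖ ^ (-(7 / 5) : ℝ) := by
  rw [integrable_fun_norm_addHaar (μ := (volume : Measure E3)) (f := fun r : ℝ =>
    Real.sqrt (1 + r ^ 2) ^ (-(19 / 10) : ℝ) * r ^ (-(7 / 5) : ℝ))]
  simp only [finrank_euclideanSpace, Fintype.card_fin, smul_eq_mul]
  have hm : Measurable fun y : ℝ => y ^ (3 - 1) *
      (Real.sqrt (1 + y ^ 2) ^ (-(19 / 10) : ℝ) * y ^ (-(7 / 5) : ℝ)) := by fun_prop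
  have e : ∀ y : ℝ, 0 < y → y ^ (3 - 1) * y ^ (-(7 / 5) : ℝ) = y ^ (3 / 5 : ℝ) := fun y hy => by
    rw [← Real.rpow_natCast, ← Real.rpow_add hy]; norm_num
  rw [← Set.Ioc_union_Ioi_eq_Ioi zero_le_one]
  refine IntegrableOn.union ?_ ?_
  · have h1 : IntegrableOn (fun y : ℝ => y ^ (3 / 5 : ℝ)) (Set.Ioc 0 1) := by
      rw [← intervalIntegrable_iff_integrableOn_Ioc_of_le zero_le_one]
      exact intervalIntegral.intervalIntegrable_rpow' (by norm_num)
    refine h1.mono' hm.aestronglyMeasurable ?_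
    refine (ae_restrict_mem measurableSet_Ioc).mono fun y hy => ?_
    have hy0 := hy.1
    rw [Real.norm_of_nonneg (by positivity), mul_left_comm, e y hy0]
    refine mul_le_of_le_one_left (by positivity) ?_
    refine Real.rpow_le_one_of_one_le_of_nonpos ?_ (by norm_num)
    exact Real.one_le_sqrt.2 (by nlinarith)
  · refine (integrableOn_Ioi_rpow_of_lt (by norm_num : (-(13 / 10) : ℝ) < -1) one_pos).mono'
      hm.aestronglyMeasurable ?_
    refine (ae_restrict_mem measurableSet_Ioi).mono fun y hy => ?_
    have hy0 : 0 < y := one_pos.trans hy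
    rw [Real.norm_of_nonneg (by positivity), mul_left_comm, e y hy0]
    calc _ ≤ y ^ (-(19 / 10) : ℝ) * y ^ (3 / 5 : ℝ) := by
          refine mul_le_mul_of_nonneg_right ?_ (by positivity)
          exact Real.rpow_le_rpow_of_nonpos hy0 (Real.le_sqrt_of_sq_le (by linarith)) (by norm_num)
      _ = _ := by rw [← Real.rpow_add hy0]; norm_num

/-! ### Integration over hyperbolic space in the chart -/

namespace HypSpace

/-- The Gram matrix is `1 - v vᵀ / (1 + |v|²)`, of determinant `1 / (1 + |v|²)`. -/
theorem sqrt_det_metricMatrix (v : E3) :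
    Real.sqrt (metricMatrix v).det = (Real.sqrt (1 + ‖v‖ ^ 2))⁻¹ := by
  have hpos : 0 < 1 + ‖v‖ ^ 2 := by positivity
  have hs : Real.sqrt (1 + ‖v‖ ^ 2) ^ 2 = 1 + ‖v‖ ^ 2 := Real.sq_sqrt hpos.le
  have hne : Real.sqrt (1 + ‖v‖ ^ 2) ≠ 0 := (Real.sqrt_pos.2 hpos).ne'
  have hn : ‖v‖ ^ 2 = v 0 ^ 2 + v 1 ^ 2 + v 2 ^ 2 := by
    rw [EuclideanSpace.norm_sq_eq, Fin.sum_univ_three]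
    simp only [Real.norm_eq_abs, sq_abs]
  have hent : ∀ i j, metricMatrix v i j =
      (if i = j then 1 else 0) - v i * v j / (1 + ‖v‖ ^ 2) := by
    intro i j
    simp only [metricMatrix, tangentVec, minkowski, Matrix.of_apply,
      EuclideanSpace.inner_single_left, map_one, one_mul, PiLp.single_apply]
    rw [div_mul_div_comm, ← sq, hs]
    ring
  have hdet : (metricMatrix v).det = (1 + ‖v‖ ^ 2)⁻¹ := by
    rw [Matrix.det_fin_three]
    simp only [hent]
    simp
    field_simp
    rw [hn]
    ring
  rw [hdet, Real.sqrt_inv]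

theorem measurable_height : Measurable height := measurable_fst.comp measurable_subtype_coe

theorem measurable_space : Measurable fun x : HypSpace => x.1.2 :=
  measurable_snd.comp measurable_subtype_coe

theorem measurable_param : Measurable param := by
  refine Measurable.subtype_mk ?_
  exact Measurable.prodMk (by fun_prop) measurable_id

/-- The global chart as a measurable equivalence. -/
noncomputable def paramEquiv : E3 ≃ᵐ HypSpace where
  toFun := param
  invFun x := x.1.2
  left_inv _ := rfl
  right_inv x := by
    refine Subtype.ext (Prod.ext ?_ rfl)
    change Real.sqrt (1 + ‖x.1.2‖ ^ 2) = x.1.1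
    rw [← height_sq, Real.sqrt_sq (height_pos x).le, height]
  measurable_toFun := measurable_param
  measurable_invFun := measurable_space

theorem lintegral_vol (f : HypSpace → ENNReal) :
    ∫⁻ x, f x ∂vol =
      ∫⁻ v : E3, ENNReal.ofReal (Real.sqrt (1 + ‖v‖ ^ 2))⁻¹ * f (param v) := by
  simp only [vol, sqrt_det_metricMatrix]
  change ∫⁻ x, f x ∂(Measure.map paramEquiv _) = _
  rw [lintegral_map_equiv, lintegral_withDensity_eq_lintegral_mul_non_measurable]
  · rfl
  · fun_prop
  · exact Filter.Eventually.of_forall fun _ => ENNReal.ofReal_lt_top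

instance : SigmaFinite vol := by
  change SigmaFinite (Measure.map paramEquiv _)
  exact paramEquiv.sigmaFinite_map

theorem measurable_coshDist : Measurable fun z : HypSpace × HypSpace => coshDist z.1 z.2 := by
  unfold coshDist minkowski
  have h1 : Measurable fun z : HypSpace × HypSpace => z.1.1.1 :=
    measurable_height.comp measurable_fst
  have h2 : Measurable fun z : HypSpace × HypSpace => z.2.1.1 :=
    measurable_height.comp measurable_snd
  have h3 : Measurable fun z : HypSpace × HypSpace => z.1.1.2 :=
    measurable_space.comp measurable_fst
  have h4 : Measurable fun z : HypSpace × HypSpace => z.2.1.2 :=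
    measurable_space.comp measurable_snd
  exact ((h1.mul h2).neg.add (h3.inner h4)).neg

theorem measurable_hdist : Measurable fun z : HypSpace × HypSpace => hdist z.1 z.2 := by
  have h : Measurable Real.arcosh := by unfold Real.arcosh; fun_prop
  exact h.comp measurable_coshDist

/-! ### The integral over one inner point -/

/-- The product of the weights of the two edges joining `y` to the apex and to `x`, restricted to
those `y` that are no farther from the apex than `x`. -/
noncomputable def innerWeight (x y : HypSpace) : ENNReal :=
  if height y ≤ height x then ENNReal.ofReal (height y ^ (-(9 / 10) : ℝ) * decay x y) else 0

theorem measurable_innerWeight :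
    Measurable fun z : HypSpace × HypSpace => innerWeight z.1 z.2 := by
  unfold innerWeight decay
  have h1 : Measurable fun z : HypSpace × HypSpace => height z.1 :=
    measurable_height.comp measurable_fst
  have h2 : Measurable fun z : HypSpace × HypSpace => height z.2 :=
    measurable_height.comp measurable_snd
  refine Measurable.ite (measurableSet_le h2 h1) ?_ measurable_const
  exact ((h2.pow_const _).mul (measurable_coshDist.pow_const _)).ennreal_ofReal

theorem exists_lintegral_innerWeight_le :
    ∃ C : ℝ, 0 ≤ C ∧ ∀ u : E3, u ≠ 0 →
      ∫⁻ y, innerWeight (param u) y ∂vol ≤ ENNReal.ofReal (C * ‖u‖ ^ (-(7 / 10) : ℝ)) := by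
  obtain ⟨C, hC, h⟩ := exists_lintegral_decay_le
  refine ⟨C, hC, fun u hu => ?_⟩
  refine le_of_eq_of_le ?_ (h u hu)
  rw [lintegral_vol]
  refine lintegral_congr fun v => ?_
  have hiff : height (param v) ≤ height (param u) ↔ ‖v‖ ≤ ‖u‖ := by
    change Real.sqrt (1 + ‖v‖ ^ 2) ≤ Real.sqrt (1 + ‖u‖ ^ 2) ↔ _
    rw [Real.sqrt_le_sqrt_iff (by positivity), add_le_add_iff_left,
      sq_le_sq₀ (norm_nonneg _) (norm_nonneg _)]
  have ht : 0 < Real.sqrt (1 + ‖v‖ ^ 2) := Real.sqrt_pos.2 (by positivity)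
  have hq : coshDist (param u) (param v) =
      Real.sqrt (1 + ‖u‖ ^ 2) * Real.sqrt (1 + ‖v‖ ^ 2) - inner ℝ u v := by
    simp only [coshDist, minkowski, param]; ring
  unfold innerWeight
  simp only [hiff]
  split_ifs
  · rw [← ENNReal.ofReal_mul (by positivity), decay, hq, ← mul_assoc]
    congr 2
    change (Real.sqrt (1 + ‖v‖ ^ 2))⁻¹ * Real.sqrt (1 + ‖v‖ ^ 2) ^ (-(9 / 10) : ℝ) = _
    rw [← Real.rpow_neg_one, ← Real.rpow_add ht]
    norm_num
  · simp

/-- The integral over the outermost point. The two inner points have been integrated out, each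
giving the same factor. -/
theorem lintegral_innerWeight_sq_lt_top :
    ∫⁻ x, ENNReal.ofReal (height x ^ (-(9 / 10) : ℝ)) * (∫⁻ y, innerWeight x y ∂vol) ^ 2 ∂vol
      < ⊤ := by
  obtain ⟨C, hC, h⟩ := exists_lintegral_innerWeight_le
  -- the bound excludes the apex itself, which is a null set
  refine lt_of_le_of_lt ?_
    (integrable_sqrt_rpow_mul_norm_rpow.const_mul (C ^ 2)).lintegral_lt_top
  rw [lintegral_vol]
  refine lintegral_mono_ae ?_
  filter_upwards [Measure.ae_ne volume (0 : E3)] with u hu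
  have hu0 : 0 < ‖u‖ := norm_pos_iff.2 hu
  have ht : 0 < Real.sqrt (1 + ‖u‖ ^ 2) := Real.sqrt_pos.2 (by positivity)
  calc _ ≤ ENNReal.ofReal (Real.sqrt (1 + ‖u‖ ^ 2))⁻¹ *
        (ENNReal.ofReal (Real.sqrt (1 + ‖u‖ ^ 2) ^ (-(9 / 10) : ℝ)) *
          ENNReal.ofReal (C * ‖u‖ ^ (-(7 / 10) : ℝ)) ^ 2) := by
        exact mul_le_mul' le_rfl (mul_le_mul' le_rfl (pow_le_pow_left' (h u hu) 2))
    _ = _ := by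
        rw [← ENNReal.ofReal_pow (by positivity), ← ENNReal.ofReal_mul (by positivity),
          ← ENNReal.ofReal_mul (by positivity)]
        congr 1
        have h1 : (‖u‖ ^ (-(7 / 10) : ℝ)) ^ 2 = ‖u‖ ^ (-(7 / 5) : ℝ) := by
          rw [← Real.rpow_natCast, ← Real.rpow_mul hu0.le]; norm_num
        have h2 : (Real.sqrt (1 + ‖u‖ ^ 2))⁻¹ * Real.sqrt (1 + ‖u‖ ^ 2) ^ (-(9 / 10) : ℝ) =
            Real.sqrt (1 + ‖u‖ ^ 2) ^ (-(19 / 10) : ℝ) := by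
          rw [← Real.rpow_neg_one, ← Real.rpow_add ht]
          norm_num
        rw [mul_pow, h1, ← h2]
        ring

/-- Integration over the two inner points factors once the outermost point is fixed. -/
theorem lintegral_outermost (c : Fin 3) :
    ∫⁻ y : Fin 3 → HypSpace, ENNReal.ofReal (height (y c) ^ (-(9 / 10) : ℝ)) *
        ∏ i : Fin 2, innerWeight (y c) (y (c.succAbove i)) ∂(Measure.pi fun _ => vol) =
      ∫⁻ x, ENNReal.ofReal (height x ^ (-(9 / 10) : ℝ)) *
        (∫⁻ y, innerWeight x y ∂vol) ^ 2 ∂vol := by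
  have hm : ∀ i : Fin 2, Measurable fun z : HypSpace × (Fin 2 → HypSpace) =>
      innerWeight z.1 (z.2 i) := fun i =>
    measurable_innerWeight.comp
      (measurable_fst.prodMk ((measurable_pi_apply i).comp measurable_snd))
  have hh : Measurable fun z : HypSpace × (Fin 2 → HypSpace) =>
      ENNReal.ofReal (height z.1 ^ (-(9 / 10) : ℝ)) :=
    ((measurable_height.comp measurable_fst).pow_const _).ennreal_ofReal
  refine ((measurePreserving_piFinSuccAbove (fun _ : Fin 3 => vol) c).lintegral_comp_emb
    (MeasurableEquiv.measurableEmbedding _) (fun z : HypSpace × (Fin 2 → HypSpace) =>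
      ENNReal.ofReal (height z.1 ^ (-(9 / 10) : ℝ)) * ∏ i, innerWeight z.1 (z.2 i))).trans ?_
  have hmeas : Measurable fun z : HypSpace × (Fin 2 → HypSpace) =>
      ENNReal.ofReal (height z.1 ^ (-(9 / 10) : ℝ)) * ∏ i, innerWeight z.1 (z.2 i) :=
    hh.mul (Finset.measurable_fun_prod _ fun i _ => hm i)
  rw [lintegral_prod _ hmeas.aemeasurable]
  refine lintegral_congr fun x => ?_
  dsimp only
  rw [lintegral_const_mul' _ _ ENNReal.ofReal_ne_top]
  congr 1
  have hx : Measurable (innerWeight x) := measurable_innerWeight.comp measurable_prodMk_left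
  rw [← (measurePreserving_finTwoArrow vol).symm.lintegral_comp_emb
    (MeasurableEquiv.measurableEmbedding _)]
  simp only [Fin.prod_univ_two]
  rw [sq, ← lintegral_prod_mul hx.aemeasurable hx.aemeasurable]
  rfl

end HypSpace

/-! ### The integral over three points -/

namespace HypSpace

/-- If `y c` is the outermost of three points, the weight of the edge between the other two may be
dropped; the sum over `c` covers all configurations. -/
theorem ofReal_prod_decay_le (y : Fin 3 → HypSpace) :
    ENNReal.ofReal ((∏ i, height (y i) ^ (-(9 / 10) : ℝ)) *
        (decay (y 0) (y 1) * decay (y 0) (y 2) * decay (y 1) (y 2))) ≤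
      ∑ c, ENNReal.ofReal (height (y c) ^ (-(9 / 10) : ℝ)) *
        ∏ i : Fin 2, innerWeight (y c) (y (c.succAbove i)) := by
  obtain ⟨c, hc⟩ := Finite.exists_max fun i => height (y i)
  refine le_trans ?_ (Finset.single_le_sum (fun _ _ => zero_le) (Finset.mem_univ c))
  have hh : ∀ i, 0 ≤ height (y i) ^ (-(9 / 10) : ℝ) := fun i =>
    Real.rpow_nonneg (height_pos _).le _
  have hd : ∀ i j, 0 ≤ decay (y i) (y j) := fun i j => decay_nonneg _ _
  simp only [Fin.prod_univ_two, innerWeight, hc, if_true]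
  rw [← ENNReal.ofReal_mul (mul_nonneg (hh _) (hd _ _)), ← ENNReal.ofReal_mul (hh _)]
  refine ENNReal.ofReal_le_ofReal ?_
  rw [Fin.prod_univ_three]
  have key : ∀ i j, decay (y c) (y i) * decay (y c) (y j) * decay (y i) (y j) ≤
      decay (y c) (y i) * decay (y c) (y j) := fun i j =>
    mul_le_of_le_one_right (mul_nonneg (hd _ _) (hd _ _)) (decay_le_one _ _)
  have hprod := mul_nonneg (mul_nonneg (hh 0) (hh 1)) (hh 2)
  fin_cases c
  · have := mul_le_mul_of_nonneg_left (key 1 2) hprod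
    refine this.trans_eq ?_
    change _ = _ * (height (y 1) ^ (-(9 / 10) : ℝ) * decay (y 0) (y 1) *
      (height (y 2) ^ (-(9 / 10) : ℝ) * decay (y 0) (y 2)))
    simp only [Fin.zero_eta]
    ring
  · have := mul_le_mul_of_nonneg_left (key 0 2) hprod
    refine le_of_eq_of_le ?_ (this.trans_eq ?_)
    · simp only [Fin.mk_one]
      rw [decay_comm (y 1) (y 0)]
      ring
    · change _ = _ * (height (y 0) ^ (-(9 / 10) : ℝ) * decay (y 1) (y 0) *
        (height (y 2) ^ (-(9 / 10) : ℝ) * decay (y 1) (y 2)))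
      simp only [Fin.mk_one]
      ring
  · have := mul_le_mul_of_nonneg_left (key 0 1) hprod
    refine le_of_eq_of_le ?_ (this.trans_eq ?_)
    · simp only [Fin.reduceFinMk]
      rw [decay_comm (y 2) (y 0), decay_comm (y 2) (y 1)]
      ring
    · change _ = _ * (height (y 0) ^ (-(9 / 10) : ℝ) * decay (y 2) (y 0) *
        (height (y 1) ^ (-(9 / 10) : ℝ) * decay (y 2) (y 1)))
      simp only [Fin.reduceFinMk]
      ring

theorem lintegral_prod_decay_lt_top :
    ∫⁻ y : Fin 3 → HypSpace, ENNReal.ofReal ((∏ i, height (y i) ^ (-(9 / 10) : ℝ)) *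
        (decay (y 0) (y 1) * decay (y 0) (y 2) * decay (y 1) (y 2)))
      ∂(Measure.pi fun _ => vol) < ⊤ := by
  refine lt_of_le_of_lt (lintegral_mono ofReal_prod_decay_le) ?_
  rw [lintegral_finsetSum]
  · simp_rw [lintegral_outermost]
    exact ENNReal.sum_lt_top.2 fun _ _ => lintegral_innerWeight_sq_lt_top
  · intro c _
    refine Measurable.mul ?_ (Finset.measurable_fun_prod _ fun i _ => ?_)
    · exact ((measurable_height.comp (measurable_pi_apply c)).pow_const _).ennreal_ofReal
    · have hpair : Measurable fun y : Fin 3 → HypSpace => (y c, y (c.succAbove i)) :=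
        (measurable_pi_apply c).prodMk (measurable_pi_apply (c.succAbove i))
      exact measurable_innerWeight.comp hpair

end HypSpace

/-! ### Reduction of the network integral -/

namespace NetworkGraph

variable {V E : Type}

theorem measurable_extend [DecidableEq V] (w : V) (xw : HypSpace) (v : V) :
    Measurable fun y : {v : V // v ≠ w} → HypSpace => extend w xw y v := by
  by_cases h : v = w
  · simp [extend, h]
  · simpa [extend, h] using measurable_pi_apply _

theorem measurable_integrand_extend [DecidableEq V] [Fintype E] (G : NetworkGraph V E)
    (p : E → ℝ≥0) (w : V) (xw : HypSpace) :
    Measurable fun y : {v : V // v ≠ w} → HypSpace => G.integrand p (extend w xw y) := by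
  unfold integrand
  refine Finset.measurable_fun_prod _ fun e _ => ?_
  generalize G.ends e = s
  induction s with
  | h a b =>
    have hk : Measurable (kernelK (p e)) := by
      unfold kernelK
      refine Measurable.ite (measurableSet_singleton 0) measurable_const ?_
      split_ifs <;> fun_prop
    exact hk.comp (HypSpace.measurable_hdist.comp
      ((measurable_extend w xw a).prodMk (measurable_extend w xw b)))

end NetworkGraph

/-- The six edges of the tetrahedron, sorted by whether they contain the vertex `w`. -/
theorem prod_edgeSet_top_fin_four (g : Sym2 (Fin 4) → ℝ) (w : Fin 4)
    [Fintype (⊤ : SimpleGraph (Fin 4)).edgeSet] :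
    ∏ e : (⊤ : SimpleGraph (Fin 4)).edgeSet, g e.1 =
      (∏ i : Fin 3, g s(w, w.succAbove i)) * (g s(w.succAbove 0, w.succAbove 1) *
        g s(w.succAbove 0, w.succAbove 2) * g s(w.succAbove 1, w.succAbove 2)) := by
  have h : ∏ e : (⊤ : SimpleGraph (Fin 4)).edgeSet, g e.1 =
      ∏ e ∈ ({s(0, 1), s(0, 2), s(0, 3), s(1, 2), s(1, 3), s(2, 3)} : Finset (Sym2 (Fin 4))),
        g e := by
    refine (Finset.prod_subtype _ (fun x => ?_) _).symm
    revert x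
    decide
  rw [h, Finset.prod_insert (by decide), Finset.prod_insert (by decide),
    Finset.prod_insert (by decide), Finset.prod_insert (by decide), Finset.prod_insert (by decide),
    Finset.prod_singleton, Fin.prod_univ_three]
  have h10 : s((1 : Fin 4), 0) = s(0, 1) := Sym2.eq_swap
  have h20 : s((2 : Fin 4), 0) = s(0, 2) := Sym2.eq_swap
  have h30 : s((3 : Fin 4), 0) = s(0, 3) := Sym2.eq_swap
  have h21 : s((2 : Fin 4), 1) = s(1, 2) := Sym2.eq_swap
  have h31 : s((3 : Fin 4), 1) = s(1, 3) := Sym2.eq_swap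
  have h32 : s((3 : Fin 4), 2) = s(2, 3) := Sym2.eq_swap
  fin_cases w
  · change _ = g s(0, 1) * g s(0, 2) * g s(0, 3) * (g s(1, 2) * g s(1, 3) * g s(2, 3))
    ring
  · change _ = g s(1, 0) * g s(1, 2) * g s(1, 3) * (g s(0, 2) * g s(0, 3) * g s(2, 3))
    rw [h10]; ring
  · change _ = g s(2, 0) * g s(2, 1) * g s(2, 3) * (g s(0, 1) * g s(0, 3) * g s(1, 3))
    rw [h20, h21]; ring
  · change _ = g s(3, 0) * g s(3, 1) * g s(3, 2) * (g s(0, 1) * g s(0, 2) * g s(1, 2))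
    rw [h30, h31, h32]; ring

open HypSpace NetworkGraph in
/-- Reduction to real weights: up to a constant depending on the fixed point, the integrand is
bounded by powers of the heights of the free points and the weights of the edges between them. -/
theorem exists_abs_integrand_tetrahedron_le (w : Fin 4) (xw : HypSpace)
    [Fintype (⊤ : SimpleGraph (Fin 4)).edgeSet] :
    ∃ C : ℝ, 0 ≤ C ∧ ∀ (p : (⊤ : SimpleGraph (Fin 4)).edgeSet → ℝ≥0) (x : Fin 4 → HypSpace),
      x w = xw → |tetrahedron.integrand p x| ≤
        C * ((∏ i, height (x (w.succAbove i)) ^ (-(9 / 10) : ℝ)) *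
          (decay (x (w.succAbove 0)) (x (w.succAbove 1)) *
            decay (x (w.succAbove 0)) (x (w.succAbove 2)) *
            decay (x (w.succAbove 1)) (x (w.succAbove 2)))) := by
  obtain ⟨C, hC, h⟩ := exists_decay_le_height_rpow xw
  refine ⟨(∏ _i : Fin 3, 40 * C) * 40 ^ 3, by positivity, fun p x hx => ?_⟩
  let g : Sym2 (Fin 4) → ℝ := Sym2.lift ⟨fun a b => 40 * decay (x a) (x b),
    fun a b => by simp only [decay_comm]⟩
  have hg : ∀ a b, g s(a, b) = 40 * decay (x a) (x b) := fun a b => rfl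
  have hle : |tetrahedron.integrand p x| ≤
      ∏ e : (⊤ : SimpleGraph (Fin 4)).edgeSet, g e.1 := by
    unfold integrand
    rw [Finset.abs_prod]
    refine Finset.prod_le_prod (fun _ _ => abs_nonneg _) fun e _ => ?_
    change |edgeFactor x (p e) e.1| ≤ g e.1
    generalize e.1 = s
    induction s with
    | h a b => exact abs_kernelK_hdist_le (p e) (x a) (x b)
  rw [prod_edgeSet_top_fin_four g w] at hle
  simp only [hg, hx] at hle
  have hprod : ∏ i : Fin 3, 40 * decay xw (x (w.succAbove i)) ≤
      (∏ _i : Fin 3, 40 * C) * ∏ i, height (x (w.succAbove i)) ^ (-(9 / 10) : ℝ) := by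
    rw [← Finset.prod_mul_distrib]
    refine Finset.prod_le_prod (fun i _ => mul_nonneg (by norm_num) (decay_nonneg _ _))
      fun i _ => ?_
    rw [mul_assoc]
    exact mul_le_mul_of_nonneg_left (h _) (by norm_num)
  have hd : 0 ≤ decay (x (w.succAbove 0)) (x (w.succAbove 1)) *
      decay (x (w.succAbove 0)) (x (w.succAbove 2)) *
      decay (x (w.succAbove 1)) (x (w.succAbove 2)) :=
    mul_nonneg (mul_nonneg (decay_nonneg _ _) (decay_nonneg _ _)) (decay_nonneg _ _)
  calc _ ≤ _ := hle
    _ = (∏ i : Fin 3, 40 * decay xw (x (w.succAbove i))) * (40 ^ 3 *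
        (decay (x (w.succAbove 0)) (x (w.succAbove 1)) *
          decay (x (w.succAbove 0)) (x (w.succAbove 2)) *
          decay (x (w.succAbove 1)) (x (w.succAbove 2)))) := by ring
    _ ≤ _ := mul_le_mul_of_nonneg_right hprod (mul_nonneg (by norm_num) hd)
    _ = _ := by ring

theorem theorem2 : tetrahedron.IsIntegrable := by
  intro p w xw
  have hmeas := tetrahedron.measurable_integrand_extend p w xw
  have hmp := measurePreserving_piCongrLeft (α := fun _ => HypSpace)
    (fun _ : {v : Fin 4 // v ≠ w} => HypSpace.vol) (finSuccAboveEquiv w)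
  rw [← hmp.integrable_comp_emb (MeasurableEquiv.measurableEmbedding _)]
  obtain ⟨C, hC, h⟩ := exists_abs_integrand_tetrahedron_le w xw
  refine ⟨(hmeas.comp (MeasurableEquiv.measurable _)).aestronglyMeasurable, ?_⟩
  have hfin := ENNReal.mul_lt_top (ENNReal.ofReal_lt_top (r := C))
    HypSpace.lintegral_prod_decay_lt_top
  rw [← lintegral_const_mul' _ _ ENNReal.ofReal_ne_top] at hfin
  refine lt_of_le_of_lt (lintegral_mono fun y => ?_) hfin
  rw [← ENNReal.ofReal_mul hC, Real.enorm_eq_ofReal_abs]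
  refine ENNReal.ofReal_le_ofReal ?_
  set x := NetworkGraph.extend w xw
    (MeasurableEquiv.piCongrLeft (fun _ => HypSpace) (finSuccAboveEquiv w) y) with hx
  have hxs : ∀ i, x (w.succAbove i) = y i := fun i => by
    have hne : w.succAbove i ≠ w := Fin.succAbove_ne w i
    simp only [hx, NetworkGraph.extend, hne, dite_false]
    exact Equiv.piCongrLeft_apply_apply (fun _ => HypSpace) (finSuccAboveEquiv w) y i
  have := h p x (by simp [hx, NetworkGraph.extend])
  simp only [hxs] at this
  exact this
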